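/- Conventions. Let $\mathbb T$ be the unit circle with normalised Lebesgue measure. For $q\in\{2,\infty\}$ let $H^q$ be the Hardy space of the exterior of the unit disc, identified with its boundary values: the functions in $L^q(\mathbb T)$ whose Fourier series is of the form $\sum_{k\ge 0}c_kz^{-k}$. Let $H^q_n$ denote the row vectors of length $n$, and $H^q_{n,m}$ the $n\times m$ matrices, with entries in $H^q$. A function $W\in H^2_{n,m}$ is *outer* if the closure in $L^2$ of the row-span $\mathrm{span}\{\phi W:\phi\in H^\infty_n\}$ is $H^2_m$. A function $Q\in H^\infty_{r,m}$ is *inner* if $Q(z)Q(z)^*=I_r$ for a.e. $z\in\mathbb T$ (for $r=m$: $Q$ is unitary a.e. on $\mathbb T$). An *outer-inner factorization* of $V\in H^2_{n,m}$ is $V=\hat V Q$ with $\hat V\in H^2_{n,r}$ outer and $Q\in H^\infty_{r,m}$ inner, for some $r$. An $m\times m$ inner function $D$ is a *right inner divisor* of an inner $Q\in H^\infty_{r,m}$ if $Q=RD$ with $R\in H^\infty_{r,m}$ inner. Inner functions $Q_1,Q_2$ with $m$ columns are *right-coprime* if every common right inner divisor of them is a constant unitary matrix. Their *greatest common right inner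 divisor* $Q_1\wedge_R Q_2$ is the $m\times m$ inner function $D$ (when it exists; unique up to a constant unitary left factor) such that $H^2_mD$ is the closed vector sum $\overline{H^2_{r_1}Q_1+H^2_{r_2}Q_2}$. Theorem. Let $m,p\ge 0$ and let $W\in H^2_{m+p,m}$ have full column rank, i.e. $\operatorname{rank}W(z)=m$ for a.e. $z\in\mathbb T$. Partition $W=\begin{bmatrix}W_1\\W_2\end{bmatrix}$ into blocks of sizes $m\times m$ and $p\times m$, and let $W_1=\hat W_1Q_1$ and $W_2=\hat W_2Q_2$ be outer-inner factorizations, with inner factors $Q_1$ of size $r_1\times m$ and $Q_2$ of size $r_2\times m$. Then $W$ is outer if and only if $Q_1$ and $Q_2$ are right-coprime; and $Q_1$ and $Q_2$ are right-coprime if and only if their greatest common right inner divisor is the identity, $Q_1\wedge_RQ_2=I_m$. -/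

import Mathlib

open MeasureTheory
open scoped ENNReal Matrix

noncomputable section

namespace HardyMatrix

/-- The unit circle, parametrised by `t ↦ z = exp (2 π i t)`. -/
abbrev Torus : Type := UnitAddCircle

/-- Normalised Lebesgue measure on the unit circle. -/
abbrev circleMeasure : Measure Torus := AddCircle.haarAddCircle

/-- Scalar Hardy class `H^q`, described by boundary values: a function in `L^q` of the unit circle
whose Fourier series has the form `∑_{k ≥ 0} c_k z^{-k}`, i.e. extends analytically to `|z| > 1`,
infinity included (for `q ≥ 1`). Constants belong to the class. -/
def IsHardy (q : ℝ≥0∞) (f : Torus → ℂ) : Prop :=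
  MemLp f q circleMeasure ∧ ∀ n : ℤ, 0 < n → fourierCoeff f n = 0

/-- A matrix function all of whose entries are in `H^q`. -/
def IsHardyMatrix {ι κ : Type*} (q : ℝ≥0∞) (F : Torus → Matrix ι κ ℂ) : Prop :=
  ∀ i j, IsHardy q (fun t => F t i j)

/-- The space `L²_κ` of square integrable (row-)vector functions on the unit circle. -/
abbrev L2 (κ : Type*) [Fintype κ] : Type _ :=
  Lp (EuclideanSpace ℂ κ) 2 circleMeasure

theorem IsHardy.congr {q : ℝ≥0∞} {f g : Torus → ℂ} (hf : IsHardy q f)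
    (h : f =ᵐ[circleMeasure] g) : IsHardy q g := by
  refine ⟨hf.1.ae_eq h, fun n hn => ?_⟩
  rw [← hf.2 n hn]
  unfold fourierCoeff
  refine integral_congr_ae ?_
  filter_upwards [h] with t ht
  rw [ht]

theorem IsHardy.zero {q : ℝ≥0∞} : IsHardy q (fun _ => 0) :=
  ⟨MemLp.zero', fun n _ => by simp [fourierCoeff]⟩

theorem IsHardy.add {q : ℝ≥0∞} (hq : 1 ≤ q) {f g : Torus → ℂ} (hf : IsHardy q f)
    (hg : IsHardy q g) : IsHardy q (fun t => f t + g t) := by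
  refine ⟨hf.1.add hg.1, fun n hn => ?_⟩
  have key : ∀ u : Torus → ℂ, MemLp u q circleMeasure →
      Integrable (fun t => fourier (-n) t • u t) circleMeasure := fun u hu =>
    (hu.integrable hq).bdd_mul (c := 1) (by fun_prop)
      (Filter.Eventually.of_forall fun t => (Circle.norm_coe _).le)
  have h1 := hf.2 n hn
  have h2 := hg.2 n hn
  unfold fourierCoeff at h1 h2 ⊢
  simp only [smul_add]
  rw [integral_add (key f hf.1) (key g hg.1), h1, h2, add_zero]

theorem IsHardy.const_smul {q : ℝ≥0∞} (c : ℂ) {f : Torus → ℂ} (hf : IsHardy q f) :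
    IsHardy q (fun t => c * f t) := by
  refine ⟨hf.1.const_mul c, fun n hn => ?_⟩
  have h := fourierCoeff.const_smul f c n
  rw [hf.2 n hn, smul_zero] at h
  exact h

/-- The Hardy space `H²_κ` of row-vector functions, as a subspace of `L²_κ`. -/
def H2 (κ : Type*) [Fintype κ] : Submodule ℂ (L2 κ) where
  carrier := {f | ∀ j, IsHardy 2 (fun t => f t j)}
  zero_mem' j := by
    refine IsHardy.zero.congr ?_
    filter_upwards [Lp.coeFn_zero (EuclideanSpace ℂ κ) 2 circleMeasure] with t ht
    rw [ht]
    rfl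
  add_mem' {f g} hf hg j := by
    refine ((hf j).add (by norm_num) (hg j)).congr ?_
    filter_upwards [Lp.coeFn_add f g] with t ht
    rw [ht]
    rfl
  smul_mem' c f hf j := by
    refine ((hf j).const_smul c).congr ?_
    filter_upwards [Lp.coeFn_smul c f] with t ht
    rw [ht]
    rfl

/-- The row-span `span {φ W ; φ ∈ H^∞_ι}` (not yet closed) of a matrix function `W`; `φ` ranges
over row vectors of bounded Hardy functions. -/
def rowSpan {ι κ : Type*} [Fintype ι] [Fintype κ] (W : Torus → Matrix ι κ ℂ) :
    Submodule ℂ (L2 κ) :=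
  Submodule.span ℂ {f | ∃ φ : Torus → ι → ℂ, (∀ i, IsHardy ∞ (fun t => φ t i)) ∧
    ∀ᵐ t ∂circleMeasure, f t = WithLp.toLp 2 (φ t ᵥ* W t)}

/-- `W ∈ H²` is outer: its closed row-span is the whole of `H²_κ`. -/
def IsOuter {ι κ : Type*} [Fintype ι] [Fintype κ] (W : Torus → Matrix ι κ ℂ) : Prop :=
  IsHardyMatrix 2 W ∧ (rowSpan W).topologicalClosure = H2 κ

/-- `Q` is inner: bounded analytic with `Q Q^* = I` a.e. on the unit circle (the row-vector
convention). A square inner function is thus unitary a.e. on the circle. -/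
def IsInner {ι κ : Type*} [Fintype κ] [DecidableEq ι]
    (Q : Torus → Matrix ι κ ℂ) : Prop :=
  IsHardyMatrix ∞ Q ∧ ∀ᵐ t ∂circleMeasure, Q t * (Q t)ᴴ = 1

/-- `W = G Q` is an outer-inner factorization: `G` is outer and `Q` is inner. -/
def IsOuterInnerFactorization {ι ρ κ : Type*} [Fintype ι] [Fintype ρ] [Fintype κ]
    [DecidableEq ρ] (W : Torus → Matrix ι κ ℂ) (G : Torus → Matrix ι ρ ℂ)
    (Q : Torus → Matrix ρ κ ℂ) : Prop :=
  IsOuter G ∧ IsInner Q ∧ ∀ᵐ t ∂circleMeasure, W t = G t * Q t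

/-- The space `H²_ρ Q = {g Q ; g ∈ H²_ρ}`. -/
def H2Mul {ρ κ : Type*} [Fintype ρ] [Fintype κ] (Q : Torus → Matrix ρ κ ℂ) :
    Submodule ℂ (L2 κ) where
  carrier := {f | ∃ g ∈ H2 ρ,
    ∀ᵐ t ∂circleMeasure, f t = WithLp.toLp 2 ((g t : ρ → ℂ) ᵥ* Q t)}
  zero_mem' := by
    refine ⟨0, Submodule.zero_mem _, ?_⟩
    filter_upwards [Lp.coeFn_zero (EuclideanSpace ℂ κ) 2 circleMeasure,
      Lp.coeFn_zero (EuclideanSpace ℂ ρ) 2 circleMeasure] with t h1 h2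
    rw [h1, h2]
    simp
  add_mem' {f₁ f₂} h₁ h₂ := by
    obtain ⟨g₁, hg₁, e₁⟩ := h₁
    obtain ⟨g₂, hg₂, e₂⟩ := h₂
    refine ⟨g₁ + g₂, Submodule.add_mem _ hg₁ hg₂, ?_⟩
    filter_upwards [e₁, e₂, Lp.coeFn_add f₁ f₂, Lp.coeFn_add g₁ g₂] with t a b c d
    rw [c, d, Pi.add_apply, Pi.add_apply, a, b, ← WithLp.toLp_add, ← Matrix.add_vecMul]
    rfl
  smul_mem' c f h := by
    obtain ⟨g, hg, e⟩ := h
    refine ⟨c • g, Submodule.smul_mem _ c hg, ?_⟩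
    filter_upwards [e, Lp.coeFn_smul c f, Lp.coeFn_smul c g] with t a b d
    rw [b, d, Pi.smul_apply, Pi.smul_apply, a, ← WithLp.toLp_smul, ← Matrix.smul_vecMul]
    rfl

/-- The square inner function `D` is a right inner divisor of the inner function `Q`:
`Q = R D` with `R` inner. -/
def IsRightInnerDivisor {ρ κ : Type*} [Fintype κ] [DecidableEq ρ] [DecidableEq κ]
    (D : Torus → Matrix κ κ ℂ) (Q : Torus → Matrix ρ κ ℂ) : Prop :=
  IsInner D ∧ ∃ R : Torus → Matrix ρ κ ℂ, IsInner R ∧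
    ∀ᵐ t ∂circleMeasure, Q t = R t * D t

/-- Right-coprimeness: the only common right inner divisors are the unitary constants. -/
def RightCoprime {ρ σ κ : Type*} [Fintype κ] [DecidableEq ρ] [DecidableEq σ] [DecidableEq κ]
    (Q₁ : Torus → Matrix ρ κ ℂ) (Q₂ : Torus → Matrix σ κ ℂ) : Prop :=
  ∀ D : Torus → Matrix κ κ ℂ, IsRightInnerDivisor D Q₁ → IsRightInnerDivisor D Q₂ →
    ∃ U ∈ Matrix.unitaryGroup κ ℂ, ∀ᵐ t ∂circleMeasure, D t = U

/-- `D` is the greatest common right inner divisor `Q₁ ∧_R Q₂` (determined up to a unitary constant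
left factor): the inner function representing the closed vector sum `H² Q₁ ∨ H² Q₂`. -/
def IsGreatestCommonRightInnerDivisor {ρ σ κ : Type*} [Fintype ρ] [Fintype σ] [Fintype κ]
    [DecidableEq κ] (D : Torus → Matrix κ κ ℂ)
    (Q₁ : Torus → Matrix ρ κ ℂ) (Q₂ : Torus → Matrix σ κ ℂ) : Prop :=
  IsInner D ∧ H2Mul D = (H2Mul Q₁ ⊔ H2Mul Q₂).topologicalClosure

end HardyMatrix

end

/-!
The statement reduces to one closed shift-invariant subspace of `H²_m`, the closed sum
`M = closure (H² Q₁ + H² Q₂)`: all three conditions say that `M = H²_m`.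

*Outerness.* Multiplication by an inner function is an isometry of `L²`, so it carries the closed
row-span `H²` of the outer factor `Gᵢ` onto the closed row-span of `Wᵢ = Gᵢ Qᵢ`, which is therefore
`H² Qᵢ` (`IsOuterInnerFactorization.closure_rowSpan`). The row-span of `W` is the sum of those of
`W₁` and `W₂` (`rowSpan_eq_sup`), hence its closure is `M`.

*Greatest common divisor.* As `H² · 1 = H²`, the identity represents `M` exactly when `M = H²_m`.

*Coprimeness* (`rightCoprime_iff_closure_eq`). A common right inner divisor `D` satisfies
`H² Qᵢ ≤ H² D`, so `M = H²_m` forces `H² D = H²_m`; then `D` and `D^*` are both analytic and `D` is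
constant (`H2Mul_eq_H2_iff`). Conversely, the Beurling–Lax theorem (`exists_isInner_H2Mul_eq`) gives
`M = H² D` with `D` inner of size `r × m`, `r ≤ m`, and `Qᵢ = Rᵢ D` with `Rᵢ` inner
(`exists_isInner_factor`). The rank of `W = [G₁ R₁; G₂ R₂] D` is at most `r`, so `r = m`. Now `D` is
a common right inner divisor, hence a constant unitary matrix, and `M = H² D = H²_m`.

The Beurling–Lax theorem is proved through the wandering subspace `M ⊖ z⁻¹M`, whose elements have
constant pointwise inner products (`inner_apply_of_mem_wandering`) because an `L¹` function without
nonzero Fourier frequencies is constant (`ae_eq_const_of_fourierCoeff`).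
-/

open Filter Topology ComplexConjugate

noncomputable section

namespace HardyMatrix

/-! ### Fourier coefficients of integrable functions -/

theorem norm_fourier_apply (n : ℤ) (t : Torus) : ‖fourier n t‖ = 1 := by
  rw [fourier_apply, Circle.norm_coe]

theorem integral_continuous_mul_eq_zero {u : Torus → ℂ} (hu : Integrable u circleMeasure)
    (h : ∀ n, fourierCoeff u n = 0) (f : C(Torus, ℂ)) :
    ∫ t, f t * u t ∂circleMeasure = 0 := by
  have hint : ∀ f : C(Torus, ℂ), Integrable (fun t => f t * u t) circleMeasure := fun f =>
    hu.bdd_mul (c := ‖f‖) f.continuous.aestronglyMeasurable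
      (Eventually.of_forall fun t => f.norm_coe_le_norm t)
  let Λ : C(Torus, ℂ) →ₗ[ℂ] ℂ :=
    { toFun := fun f => ∫ t, f t * u t ∂circleMeasure
      map_add' := fun f g => by
        rw [← integral_add (hint f) (hint g)]
        simp only [ContinuousMap.add_apply, add_mul]
      map_smul' := fun c f => by
        simp only [ContinuousMap.smul_apply, smul_eq_mul, RingHom.id_apply, mul_assoc]
        rw [integral_const_mul] }
  let L : C(Torus, ℂ) →L[ℂ] ℂ := Λ.mkContinuous (∫ t, ‖u t‖ ∂circleMeasure) fun f => by
    change ‖∫ t, f t * u t ∂circleMeasure‖ ≤ _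
    rw [mul_comm, ← integral_const_mul]
    refine norm_integral_le_of_norm_le (hu.norm.const_mul _) (Eventually.of_forall fun t => ?_)
    rw [norm_mul]
    gcongr
    exact f.norm_coe_le_norm t
  have hker : Submodule.span ℂ (Set.range (@fourier (1 : ℝ))) ≤ L.ker := by
    rw [Submodule.span_le]
    rintro _ ⟨n, rfl⟩
    have := h (-n)
    rw [fourierCoeff, neg_neg] at this
    exact this
  have htop : (⊤ : Submodule ℂ C(Torus, ℂ)) ≤ L.ker := by
    rw [← span_fourier_closure_eq_top]
    exact Submodule.topologicalClosure_minimal _ hker L.isClosed_ker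
  exact htop (Submodule.mem_top (x := f))

/-- Uniqueness of Fourier coefficients in `L¹`: trigonometric polynomials are uniformly dense in
the continuous functions, and these approximate the indicators of closed sets. -/
theorem ae_eq_zero_of_fourierCoeff_eq_zero {u : Torus → ℂ} (hu : Integrable u circleMeasure)
    (h : ∀ n, fourierCoeff u n = 0) : u =ᵐ[circleMeasure] 0 := by
  refine ae_eq_zero_of_forall_setIntegral_isClosed_eq_zero hu fun F hF => ?_
  let g : ℕ → C(Torus, ℂ) := fun n =>
    ⟨fun t => ((hF.apprSeq n t : NNReal) : ℂ), by fun_prop⟩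
  have hlim : Tendsto (fun n => ∫ t, g n t * u t ∂circleMeasure) atTop
      (𝓝 (∫ t, F.indicator u t ∂circleMeasure)) := by
    refine tendsto_integral_of_dominated_convergence (fun t => ‖u t‖)
      (fun n => (g n).continuous.aestronglyMeasurable.mul hu.1) hu.norm ?_ ?_
    · intro n
      refine Eventually.of_forall fun t => ?_
      rw [norm_mul]
      refine mul_le_of_le_one_left (norm_nonneg _) ?_
      change ‖(((hF.apprSeq n t : NNReal) : ℝ) : ℂ)‖ ≤ 1
      rw [Complex.norm_real, NNReal.norm_eq]
      exact_mod_cast HasOuterApproxClosed.apprSeq_apply_le_one hF n t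
    · refine Eventually.of_forall fun t => ?_
      have h1 := (tendsto_pi_nhds.1 (HasOuterApproxClosed.tendsto_apprSeq hF)) t
      have h2 : Tendsto (fun n => g n t) atTop
          (𝓝 (((F.indicator (fun _ => (1 : NNReal)) t : NNReal) : ℝ) : ℂ)) :=
        (Complex.continuous_ofReal.tendsto _).comp ((NNReal.continuous_coe.tendsto _).comp h1)
      have h3 := h2.mul_const (u t)
      convert h3 using 2
      by_cases ht : t ∈ F <;> simp [ht]
  simp only [integral_continuous_mul_eq_zero hu h] at hlim
  rw [← integral_indicator hF.measurableSet]
  exact (tendsto_nhds_unique hlim tendsto_const_nhds)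

theorem fourierCoeff_const (c : ℂ) {n : ℤ} (hn : n ≠ 0) :
    fourierCoeff (fun _ : Torus => c) n = 0 := by
  have h2 : fourierCoeff (fun _ : Torus => (1 : ℂ)) n = 0 := by
    have h := (orthonormal_fourier (T := 1)).2 hn
    rw [← coe_fourierBasis, ← HilbertBasis.repr_apply_apply, fourierBasis_repr,
      coe_fourierBasis] at h
    rw [← h]
    refine integral_congr_ae ?_
    filter_upwards [coeFn_fourierLp (T := 1) 2 0] with t ht
    rw [ht, fourier_zero]
  have h3 := fourierCoeff.const_mul (fun _ : Torus => (1 : ℂ)) c n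
  simpa [h2] using h3

/-- An integrable function with only its zeroth Fourier coefficient is constant. -/
theorem ae_eq_const_of_fourierCoeff {u : Torus → ℂ} (hu : Integrable u circleMeasure)
    (h : ∀ n, n ≠ 0 → fourierCoeff u n = 0) :
    ∀ᵐ t ∂circleMeasure, u t = ∫ s, u s ∂circleMeasure := by
  set c := ∫ s, u s ∂circleMeasure with hc
  have h0 : ∀ n, fourierCoeff (u + fun _ => -c) n = 0 := by
    intro n
    rw [fourierCoeff.add hu (integrable_const _)]
    by_cases hn : n = 0
    · subst hn
      simp [fourierCoeff, hc]
    · rw [Pi.add_apply, h n hn, fourierCoeff_const _ hn, add_zero]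
  filter_upwards [ae_eq_zero_of_fourierCoeff_eq_zero (hu.add (integrable_const _)) h0] with t ht
  have : u t + -c = 0 := ht
  linear_combination this

theorem fourierCoeff_conj (f : Torus → ℂ) (n : ℤ) :
    fourierCoeff (fun t => conj (f t)) n = conj (fourierCoeff f (-n)) := by
  rw [fourierCoeff, fourierCoeff, ← integral_conj]
  refine integral_congr_ae (Eventually.of_forall fun t => ?_)
  simp

/-- A function that is analytic together with its conjugate is constant. -/
theorem IsHardy.ae_eq_const_of_conj {q : ℝ≥0∞} (hq : 1 ≤ q) {f : Torus → ℂ} (hf : IsHardy q f)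
    (hf' : IsHardy q (fun t => conj (f t))) :
    ∀ᵐ t ∂circleMeasure, f t = ∫ s, f s ∂circleMeasure := by
  refine ae_eq_const_of_fourierCoeff (hf.1.integrable hq) fun n hn => ?_
  rcases lt_or_gt_of_ne hn with h | h
  · have := hf'.2 (-n) (by omega)
    rw [fourierCoeff_conj, neg_neg] at this
    simpa using this
  · exact hf.2 n h

/-! ### Monomials and the space `H²` -/

variable {ι ρ σ κ : Type*}

/-- The vector monomial `zⁿ e_j` of `L²_κ`. -/
def monomial [Fintype κ] [DecidableEq κ] (n : ℤ) (j : κ) : L2 κ :=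
  MemLp.toLp (fun t => WithLp.toLp 2 (Pi.single j (fourier n t))) <| by
    refine MemLp.of_eval_piLp fun i => ?_
    refine MemLp.of_bound (C := 1) ?_ (Eventually.of_forall fun t => ?_)
    · by_cases h : i = j
      · subst h; simpa [-fourier_apply] using (fourier n).continuous.aestronglyMeasurable
      · simpa [h] using aestronglyMeasurable_const
    · by_cases h : i = j
      · subst h; simp [-fourier_apply, norm_fourier_apply]
      · simp [h]

theorem coeFn_monomial [Fintype κ] [DecidableEq κ] (n : ℤ) (j : κ) :
    ∀ᵐ t ∂circleMeasure,
      (monomial n j : L2 κ) t = WithLp.toLp 2 (Pi.single j (fourier n t)) :=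
  MemLp.coeFn_toLp _

theorem inner_monomial [Fintype κ] [DecidableEq κ] (n : ℤ) (j : κ) (f : L2 κ) :
    inner ℂ (monomial n j) f = fourierCoeff (fun t => f t j) n := by
  rw [L2.inner_def, fourierCoeff]
  refine integral_congr_ae ?_
  filter_upwards [coeFn_monomial n j] with t ht
  rw [ht, EuclideanSpace.inner_eq_star_dotProduct, fourier_neg]
  simp [dotProduct, Pi.single_apply, mul_comm, apply_ite conj]

theorem memLp_coord [Fintype κ] (f : L2 κ) (j : κ) : MemLp (fun t => f t j) 2 circleMeasure :=
  (Lp.memLp f).eval_piLp j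

theorem mem_H2_iff [Fintype κ] [DecidableEq κ] (f : L2 κ) :
    f ∈ H2 κ ↔ ∀ n : ℤ, 0 < n → ∀ j, inner ℂ (monomial n j) f = 0 := by
  simp only [inner_monomial]
  exact ⟨fun h n hn j => (h j).2 n hn, fun h j => ⟨memLp_coord f j, fun n hn => h n hn j⟩⟩

theorem isClosed_H2 [Fintype κ] : IsClosed (H2 κ : Set (L2 κ)) := by
  classical
  have : (H2 κ : Set (L2 κ)) =
      ⋂ (n : ℤ) (_ : 0 < n) (j : κ), {f | inner ℂ (monomial n j) f = 0} := by
    ext f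
    simp [mem_H2_iff]
  rw [this]
  exact isClosed_iInter fun n => isClosed_iInter fun _ => isClosed_iInter fun j =>
    isClosed_eq (by fun_prop) continuous_const

theorem eq_zero_of_inner_monomial [Fintype κ] [DecidableEq κ] {f : L2 κ}
    (h : ∀ n j, inner ℂ (monomial n j) f = 0) : f = 0 := by
  have hj : ∀ᵐ t ∂circleMeasure, ∀ j, f t j = 0 := by
    rw [eventually_countable_forall]
    intro j
    refine ae_eq_zero_of_fourierCoeff_eq_zero ((memLp_coord f j).integrable (by norm_num))
      fun n => ?_
    rw [← inner_monomial, h]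
  refine Lp.ext ?_
  filter_upwards [hj, Lp.coeFn_zero (EuclideanSpace ℂ κ) 2 circleMeasure] with t h1 h2
  rw [h2]
  ext j
  exact h1 j

theorem inner_monomial_monomial [Fintype κ] [DecidableEq κ] {n k : ℤ} (hnk : n ≠ k) (i j : κ) :
    inner ℂ (monomial n i) (monomial k j) = 0 := by
  rw [inner_monomial]
  by_cases h : i = j
  · subst h
    rw [← fourierCoeff_const 1 (sub_ne_zero.2 hnk), fourierCoeff, fourierCoeff]
    refine integral_congr_ae ?_
    filter_upwards [coeFn_monomial k i] with t ht
    rw [ht]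
    simp only [Pi.single_eq_same, smul_eq_mul, mul_one]
    rw [← fourier_add]
    congr 2
    ring
  · rw [← fourierCoeff_const 0 (sub_ne_zero.2 hnk), fourierCoeff, fourierCoeff]
    refine integral_congr_ae ?_
    filter_upwards [coeFn_monomial k j] with t ht
    rw [ht]
    simp [h]

theorem monomial_mem_H2 [Fintype κ] [DecidableEq κ] {n : ℤ} (hn : n ≤ 0) (j : κ) :
    (monomial n j : L2 κ) ∈ H2 κ := by
  rw [mem_H2_iff]
  intro k hk i
  exact inner_monomial_monomial (by omega) i j

/-- The monomials `z^{-k} e_j`, `k ≥ 0`, span a dense subspace of `H²_κ`. -/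
theorem H2_le_of_monomial_mem [Fintype κ] [DecidableEq κ] {N : Submodule ℂ (L2 κ)}
    (hN : IsClosed (N : Set (L2 κ))) (h : ∀ n : ℤ, n ≤ 0 → ∀ j, monomial n j ∈ N) :
    H2 κ ≤ N := by
  have : CompleteSpace N := hN.completeSpace_coe
  intro f hf
  set K := N ⊓ H2 κ with hK
  have : IsClosed (K : Set (L2 κ)) := hN.inter isClosed_H2
  have : CompleteSpace K := this.completeSpace_coe
  obtain ⟨y, hy, z, hz, rfl⟩ := K.exists_add_mem_mem_orthogonal f
  have hzH : z ∈ H2 κ := by simpa using Submodule.sub_mem _ hf hy.2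
  have : z = 0 := by
    refine eq_zero_of_inner_monomial fun n j => ?_
    rcases le_or_gt n 0 with hn | hn
    · exact (K.mem_orthogonal z).1 hz _ ⟨h n hn j, monomial_mem_H2 hn j⟩
    · exact (mem_H2_iff z).1 hzH n hn j
  rw [this, add_zero]
  exact hy.1

/-! ### Multiplication by coisometric matrix functions -/

theorem inner_vecMul [Fintype ρ] [Fintype κ] [DecidableEq ρ] {A : Matrix ρ κ ℂ}
    (hA : A * Aᴴ = 1) (v w : EuclideanSpace ℂ ρ) :
    inner ℂ (WithLp.toLp 2 ((v : ρ → ℂ) ᵥ* A)) (WithLp.toLp 2 ((w : ρ → ℂ) ᵥ* A)) =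
      inner ℂ v w := by
  simp only [EuclideanSpace.inner_eq_star_dotProduct]
  rw [Matrix.star_vecMul, ← Matrix.dotProduct_mulVec, Matrix.mulVec_mulVec, hA,
    Matrix.one_mulVec]

theorem norm_vecMul [Fintype ρ] [Fintype κ] [DecidableEq ρ] {A : Matrix ρ κ ℂ}
    (hA : A * Aᴴ = 1) (v : EuclideanSpace ℂ ρ) :
    ‖WithLp.toLp 2 ((v : ρ → ℂ) ᵥ* A)‖ = ‖v‖ := by
  rw [@norm_eq_sqrt_re_inner ℂ, inner_vecMul hA, ← @norm_eq_sqrt_re_inner ℂ]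

theorem norm_entry_le_one [Fintype ρ] [Fintype κ] [DecidableEq ρ] {A : Matrix ρ κ ℂ}
    (hA : A * Aᴴ = 1) (i : ρ) (j : κ) : ‖A i j‖ ≤ 1 := by
  have h := norm_vecMul hA (WithLp.toLp 2 (Pi.single i 1))
  have h2 := PiLp.norm_apply_le (WithLp.toLp 2 ((Pi.single i 1 : ρ → ℂ) ᵥ* A)) j
  rw [h] at h2
  simpa using h2

theorem memLp_vecMul [Fintype ρ] [Fintype κ] [DecidableEq ρ] {Q : Torus → Matrix ρ κ ℂ}
    (hm : ∀ i j, AEStronglyMeasurable (fun t => Q t i j) circleMeasure)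
    (hQ : ∀ᵐ t ∂circleMeasure, Q t * (Q t)ᴴ = 1) (f : L2 ρ) :
    MemLp (fun t => WithLp.toLp 2 ((f t : ρ → ℂ) ᵥ* Q t)) 2 circleMeasure := by
  refine MemLp.of_eval_piLp fun j => (Lp.memLp f).of_le ?_ ?_
  · simp only [Matrix.vecMul, dotProduct]
    exact Finset.aestronglyMeasurable_fun_sum _ fun i _ => (memLp_coord f i).1.mul (hm i j)
  · filter_upwards [hQ] with t ht
    exact (PiLp.norm_apply_le (WithLp.toLp 2 ((f t : ρ → ℂ) ᵥ* Q t)) j).trans_eq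
      (norm_vecMul ht (f t))

/-- Right multiplication `f ↦ f Q` by a measurable matrix function with `Q Q^* = 1` a.e., as a
linear isometry from `L²_ρ` into `L²_κ`. -/
def rightMul [Fintype ρ] [Fintype κ] [DecidableEq ρ] (Q : Torus → Matrix ρ κ ℂ)
    (hm : ∀ i j, AEStronglyMeasurable (fun t => Q t i j) circleMeasure)
    (hQ : ∀ᵐ t ∂circleMeasure, Q t * (Q t)ᴴ = 1) : L2 ρ →ₗᵢ[ℂ] L2 κ where
  toFun f := (memLp_vecMul hm hQ f).toLp
  map_add' f g := by
    refine Lp.ext ?_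
    filter_upwards [(memLp_vecMul hm hQ (f + g)).coeFn_toLp, (memLp_vecMul hm hQ f).coeFn_toLp,
      (memLp_vecMul hm hQ g).coeFn_toLp, Lp.coeFn_add f g,
      Lp.coeFn_add (memLp_vecMul hm hQ f).toLp (memLp_vecMul hm hQ g).toLp] with t h1 h2 h3 h4 h5
    rw [h1, h5, Pi.add_apply, h2, h3, h4, Pi.add_apply, WithLp.ofLp_add, Matrix.add_vecMul,
      WithLp.toLp_add]
  map_smul' c f := by
    refine Lp.ext ?_
    filter_upwards [(memLp_vecMul hm hQ (c • f)).coeFn_toLp, (memLp_vecMul hm hQ f).coeFn_toLp,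
      Lp.coeFn_smul c f, Lp.coeFn_smul c (memLp_vecMul hm hQ f).toLp] with t h1 h2 h3 h4
    rw [h1, RingHom.id_apply, h4, Pi.smul_apply, h2, h3, Pi.smul_apply, WithLp.ofLp_smul,
      Matrix.smul_vecMul, WithLp.toLp_smul]
  norm_map' f := by
    change ‖(memLp_vecMul hm hQ f).toLp‖ = ‖f‖
    rw [Lp.norm_def, Lp.norm_def]
    congr 1
    refine eLpNorm_congr_norm_ae ?_
    filter_upwards [(memLp_vecMul hm hQ f).coeFn_toLp, hQ] with t h1 h2
    rw [h1, norm_vecMul h2]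

section rightMul

variable [Fintype ρ] [Fintype κ] [DecidableEq ρ] {Q : Torus → Matrix ρ κ ℂ}
    (hm : ∀ i j, AEStronglyMeasurable (fun t => Q t i j) circleMeasure)
    (hQ : ∀ᵐ t ∂circleMeasure, Q t * (Q t)ᴴ = 1)

theorem coeFn_rightMul (f : L2 ρ) :
    ∀ᵐ t ∂circleMeasure, rightMul Q hm hQ f t = WithLp.toLp 2 ((f t : ρ → ℂ) ᵥ* Q t) :=
  (memLp_vecMul hm hQ f).coeFn_toLp

theorem eq_rightMul_iff (f : L2 ρ) (g : L2 κ) : g = rightMul Q hm hQ f ↔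
    ∀ᵐ t ∂circleMeasure, g t = WithLp.toLp 2 ((f t : ρ → ℂ) ᵥ* Q t) := by
  refine ⟨fun h => h ▸ coeFn_rightMul hm hQ f, fun h => Lp.ext ?_⟩
  filter_upwards [h, coeFn_rightMul hm hQ f] with t h1 h2
  rw [h1, h2]

theorem H2Mul_eq_map : H2Mul Q = (H2 ρ).map (rightMul Q hm hQ).toLinearMap := by
  ext f
  constructor
  · rintro ⟨g, hg, h⟩
    exact ⟨g, hg, ((eq_rightMul_iff hm hQ g f).2 h).symm⟩
  · rintro ⟨g, hg, rfl⟩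
    exact ⟨g, hg, coeFn_rightMul hm hQ g⟩

/-- The rows of `Q` are the images of the constant unit vectors. -/
theorem rightMul_monomial_zero (i : ρ) :
    ∀ᵐ t ∂circleMeasure, ∀ j, rightMul Q hm hQ (monomial 0 i) t j = Q t i j := by
  filter_upwards [coeFn_rightMul hm hQ (monomial 0 i), coeFn_monomial 0 i] with t h1 h2 j
  rw [h1, h2]
  simp

end rightMul

/-- Multiplication by `zⁿ` on `L²_κ`. -/
def shift [Fintype κ] [DecidableEq κ] (n : ℤ) : L2 κ →ₗᵢ[ℂ] L2 κ :=
  rightMul (fun t => fourier n t • (1 : Matrix κ κ ℂ))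
    (fun i j => by
      simp only [Matrix.smul_apply, smul_eq_mul]
      exact ((fourier n).continuous.mul continuous_const).aestronglyMeasurable)
    (Eventually.of_forall fun t => by
      rw [Matrix.conjTranspose_smul, Matrix.conjTranspose_one, Matrix.smul_mul, Matrix.one_mul,
        smul_smul, ← starRingEnd_apply, Complex.mul_conj, Complex.normSq_eq_norm_sq,
        norm_fourier_apply]
      simp)

section shift

variable [Fintype κ] [DecidableEq κ]

theorem coeFn_shift (n : ℤ) (f : L2 κ) :
    ∀ᵐ t ∂circleMeasure, shift n f t = fourier n t • f t := by
  filter_upwards [coeFn_rightMul (Q := fun t => fourier n t • (1 : Matrix κ κ ℂ)) _ _ f] with t ht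
  rw [shift, ht, Matrix.vecMul_smul, Matrix.vecMul_one]
  rfl

theorem shift_shift (a b : ℤ) (f : L2 κ) : shift a (shift b f) = shift (a + b) f := by
  refine Lp.ext ?_
  filter_upwards [coeFn_shift a (shift b f), coeFn_shift b f, coeFn_shift (a + b) f]
    with t h1 h2 h3
  rw [h1, h2, h3, fourier_add, smul_smul]

theorem shift_zero (f : L2 κ) : shift 0 f = f := by
  refine Lp.ext ?_
  filter_upwards [coeFn_shift 0 f] with t h1
  rw [h1, fourier_zero, one_smul]

theorem shift_monomial (a n : ℤ) (j : κ) : shift a (monomial n j : L2 κ) = monomial (a + n) j := by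
  refine Lp.ext ?_
  filter_upwards [coeFn_shift a (monomial n j : L2 κ), coeFn_monomial n j,
    coeFn_monomial (a + n) j] with t h1 h2 h3
  rw [h1, h2, h3, ← WithLp.toLp_smul, fourier_add, ← Pi.single_smul, smul_eq_mul]

theorem inner_shift (n : ℤ) (f g : L2 κ) : inner ℂ (shift n f) g = inner ℂ f (shift (-n) g) := by
  rw [← (shift (-n)).inner_map_map, shift_shift, neg_add_cancel, shift_zero]

theorem shift_mem_H2 {n : ℤ} (hn : n ≤ 0) {f : L2 κ} (hf : f ∈ H2 κ) : shift n f ∈ H2 κ := by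
  rw [mem_H2_iff] at hf ⊢
  intro k hk j
  rw [← neg_neg n, ← inner_shift, shift_monomial]
  exact hf _ (by omega) j

theorem rightMul_shift [Fintype ρ] [DecidableEq ρ] {Q : Torus → Matrix ρ κ ℂ}
    (hm : ∀ i j, AEStronglyMeasurable (fun t => Q t i j) circleMeasure)
    (hQ : ∀ᵐ t ∂circleMeasure, Q t * (Q t)ᴴ = 1) (n : ℤ) (f : L2 ρ) :
    rightMul Q hm hQ (shift n f) = shift n (rightMul Q hm hQ f) := by
  refine Lp.ext ?_
  filter_upwards [coeFn_rightMul hm hQ (shift n f), coeFn_rightMul hm hQ f, coeFn_shift n f,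
    coeFn_shift n (rightMul Q hm hQ f)] with t h1 h2 h3 h4
  rw [h1, h4, h2, h3, WithLp.ofLp_smul, Matrix.smul_vecMul, WithLp.toLp_smul]

end shift

/-! ### The subspaces `H² Q` -/

theorem IsInner.aestronglyMeasurable [Fintype κ] [DecidableEq ρ] {Q : Torus → Matrix ρ κ ℂ}
    (hQ : IsInner Q) (i : ρ) (j : κ) :
    AEStronglyMeasurable (fun t => Q t i j) circleMeasure := (hQ.1 i j).1.1

section inner

variable [Fintype ρ] [Fintype κ] [Fintype σ] [DecidableEq ρ] [DecidableEq σ]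
  {Q : Torus → Matrix ρ κ ℂ}

theorem IsInner.isClosed_H2Mul (hQ : IsInner Q) : IsClosed (H2Mul Q : Set (L2 κ)) := by
  rw [H2Mul_eq_map hQ.aestronglyMeasurable hQ.2]
  exact (rightMul Q hQ.aestronglyMeasurable hQ.2).isometry.isClosedEmbedding.isClosedMap _
    isClosed_H2

/-- Inclusion of the subspaces `H² Q` means divisibility of the inner functions: the coefficients of
the rows of `Q` in `H² D` make up an inner function. -/
theorem exists_isInner_factor {D : Torus → Matrix σ κ ℂ} (hQ : IsInner Q) (hD : IsInner D)
    (h : H2Mul Q ≤ H2Mul D) :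
    ∃ R : Torus → Matrix ρ σ ℂ, IsInner R ∧ ∀ᵐ t ∂circleMeasure, Q t = R t * D t := by
  have hrow : ∀ i, rightMul Q hQ.aestronglyMeasurable hQ.2 (monomial 0 i) ∈ H2Mul D := by
    intro i
    refine h ?_
    rw [H2Mul_eq_map hQ.aestronglyMeasurable hQ.2]
    exact ⟨_, monomial_mem_H2 le_rfl i, rfl⟩
  choose g hg hgD using hrow
  have hfac : ∀ᵐ t ∂circleMeasure, Q t = (Matrix.of fun i k => g i t k) * D t := by
    filter_upwards [eventually_countable_forall.2 hgD, eventually_countable_forall.2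
      (rightMul_monomial_zero hQ.aestronglyMeasurable hQ.2)] with t h1 h2
    ext i j
    rw [← h2 i j, h1 i]
    rfl
  have hone : ∀ᵐ t ∂circleMeasure, (Matrix.of fun i k => g i t k : Matrix ρ σ ℂ) *
      (Matrix.of fun i k => g i t k : Matrix ρ σ ℂ)ᴴ = 1 := by
    filter_upwards [hfac, hQ.2, hD.2] with t h1 h2 h3
    rw [h1, Matrix.conjTranspose_mul, Matrix.mul_assoc, ← Matrix.mul_assoc (D t), h3,
      Matrix.one_mul] at h2
    exact h2
  refine ⟨fun t => Matrix.of fun i k => g i t k, ⟨fun i k => ⟨?_, (hg i k).2⟩, hone⟩, hfac⟩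
  refine memLp_top_of_bound (memLp_coord (g i) k).1 1 ?_
  filter_upwards [hone] with t ht
  exact norm_entry_le_one ht i k

variable [DecidableEq κ]

theorem shift_mem_H2Mul (hQ : IsInner Q) {n : ℤ} (hn : n ≤ 0) {f : L2 κ} (hf : f ∈ H2Mul Q) :
    shift n f ∈ H2Mul Q := by
  rw [H2Mul_eq_map hQ.aestronglyMeasurable hQ.2] at hf ⊢
  obtain ⟨g, hg, rfl⟩ := hf
  exact ⟨shift n g, shift_mem_H2 hn hg, rightMul_shift _ _ n g⟩

/-- `H² Q` is the closed subspace generated by the rows of `Q` under multiplication by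
`z^{-k}`, `k ≥ 0`. -/
theorem H2Mul_le (hQ : IsInner Q) {N : Submodule ℂ (L2 κ)} (hN : IsClosed (N : Set (L2 κ)))
    (hshift : ∀ n : ℤ, n ≤ 0 → ∀ f ∈ N, shift n f ∈ N)
    (h : ∀ i, rightMul Q hQ.aestronglyMeasurable hQ.2 (monomial 0 i) ∈ N) : H2Mul Q ≤ N := by
  rw [H2Mul_eq_map hQ.aestronglyMeasurable hQ.2, Submodule.map_le_iff_le_comap]
  refine H2_le_of_monomial_mem
    (hN.preimage (rightMul Q hQ.aestronglyMeasurable hQ.2).continuous) fun n hn j => ?_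
  have := hshift n hn _ (h j)
  rwa [← rightMul_shift, shift_monomial, add_zero] at this

theorem H2Mul_le_H2 (hQ : IsInner Q) : H2Mul Q ≤ H2 κ := by
  refine H2Mul_le hQ isClosed_H2 (fun n hn f hf => shift_mem_H2 hn hf) fun i j => ?_
  have h : IsHardy 2 (fun t => Q t i j) := ⟨(hQ.1 i j).1.mono_exponent le_top, (hQ.1 i j).2⟩
  refine h.congr ?_
  filter_upwards [rightMul_monomial_zero hQ.aestronglyMeasurable hQ.2 i] with t ht
  exact (ht j).symm

theorem isInner_const {U : Matrix κ κ ℂ} (hU : U * Uᴴ = 1) : IsInner (fun _ => U) :=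
  ⟨fun _ _ => ⟨memLp_const _, fun _ hn => fourierCoeff_const _ hn.ne'⟩,
    Eventually.of_forall fun _ => hU⟩

theorem isInner_one : IsInner (fun _ => (1 : Matrix κ κ ℂ)) := isInner_const (by simp)

theorem H2Mul_one : H2Mul (fun _ => (1 : Matrix κ κ ℂ)) = H2 κ := by
  refine le_antisymm (H2Mul_le_H2 isInner_one) fun f hf => ⟨f, hf, ?_⟩
  refine Eventually.of_forall fun t => ?_
  rw [Matrix.vecMul_one]

end inner

/-! ### Closed row-spans -/

section rowSpan

variable [Fintype ι] [Fintype κ] [Fintype ρ] [Fintype σ]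

theorem memLp_vecMul_of_bounded {V : Torus → Matrix ι κ ℂ} (hV : IsHardyMatrix 2 V)
    {φ : Torus → ι → ℂ} (hφ : ∀ i, IsHardy ∞ (fun t => φ t i)) :
    MemLp (fun t => WithLp.toLp 2 (φ t ᵥ* V t)) 2 circleMeasure := by
  refine MemLp.of_eval_piLp fun j => ?_
  simp only [Matrix.vecMul, dotProduct]
  exact memLp_finsetSum _ fun i _ => (hV i j).1.mul (hφ i).1

/-- If `V = G Q` is an outer-inner factorization, the closed row-span of `V` is `H² Q`. -/
theorem IsOuterInnerFactorization.closure_rowSpan [DecidableEq ρ] {V : Torus → Matrix ι κ ℂ}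
    {G : Torus → Matrix ι ρ ℂ} {Q : Torus → Matrix ρ κ ℂ}
    (h : IsOuterInnerFactorization V G Q) : (rowSpan V).topologicalClosure = H2Mul Q := by
  obtain ⟨hG, hQ, hV⟩ := h
  set T := rightMul Q hQ.aestronglyMeasurable hQ.2 with hT
  have hmap : rowSpan V = (rowSpan G).map T.toLinearMap := by
    rw [rowSpan, rowSpan, Submodule.map_span]
    congr 1
    ext f
    constructor
    · rintro ⟨φ, hφ, hf⟩
      refine ⟨(memLp_vecMul_of_bounded hG.1 hφ).toLp, ⟨φ, hφ, MemLp.coeFn_toLp _⟩, ?_⟩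
      refine ((eq_rightMul_iff _ _ _ f).2 ?_).symm
      filter_upwards [hf, hV, (memLp_vecMul_of_bounded hG.1 hφ).coeFn_toLp] with t h1 h2 h3
      rw [h1, h2, h3, Matrix.vecMul_vecMul]
    · rintro ⟨g, ⟨φ, hφ, hg⟩, rfl⟩
      refine ⟨φ, hφ, ?_⟩
      filter_upwards [hg, hV, coeFn_rightMul hQ.aestronglyMeasurable hQ.2 g] with t h1 h2 h3
      refine h3.trans ?_
      rw [h1, h2, Matrix.vecMul_vecMul]
  rw [H2Mul_eq_map hQ.aestronglyMeasurable hQ.2, ← hG.2, hmap]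
  refine SetLike.coe_injective ?_
  exact T.isometry.isClosedEmbedding.closure_image_eq _

theorem closure_sup_closure (A B : Submodule ℂ (L2 κ)) :
    (A.topologicalClosure ⊔ B.topologicalClosure).topologicalClosure =
      (A ⊔ B).topologicalClosure := by
  refine le_antisymm (Submodule.topologicalClosure_minimal _ (sup_le ?_ ?_)
    (Submodule.isClosed_topologicalClosure _)) (Submodule.topologicalClosure_mono
      (sup_le_sup (Submodule.le_topologicalClosure _) (Submodule.le_topologicalClosure _)))
  · exact Submodule.topologicalClosure_mono le_sup_left
  · exact Submodule.topologicalClosure_mono le_sup_right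

theorem rowSpan_eq_sup {W : Torus → Matrix (ι ⊕ σ) κ ℂ} (hW : IsHardyMatrix 2 W) :
    rowSpan W = rowSpan (fun t => (W t).toRows₁) ⊔ rowSpan (fun t => (W t).toRows₂) := by
  have hsplit : ∀ (a : ι → ℂ) (b : σ → ℂ) (A : Matrix (ι ⊕ σ) κ ℂ),
      Sum.elim a b ᵥ* A = a ᵥ* A.toRows₁ + b ᵥ* A.toRows₂ := fun a b A => by
    conv_lhs => rw [← Matrix.fromRows_toRows A]
    exact Matrix.sumElim_vecMul_fromRows _ _ _ _
  refine le_antisymm ?_ (sup_le ?_ ?_)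
  · refine Submodule.span_le.2 ?_
    rintro f ⟨φ, hφ, hf⟩
    have hW₁ : IsHardyMatrix 2 (fun t => (W t).toRows₁) := fun i j => hW (Sum.inl i) j
    have hW₂ : IsHardyMatrix 2 (fun t => (W t).toRows₂) := fun i j => hW (Sum.inr i) j
    have m₁ := memLp_vecMul_of_bounded hW₁ (φ := fun t i => φ t (Sum.inl i)) fun i => hφ _
    have m₂ := memLp_vecMul_of_bounded hW₂ (φ := fun t i => φ t (Sum.inr i)) fun i => hφ _
    have hf' : f = m₁.toLp + m₂.toLp := by
      refine Lp.ext ?_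
      filter_upwards [hf, m₁.coeFn_toLp, m₂.coeFn_toLp, Lp.coeFn_add m₁.toLp m₂.toLp]
        with t h1 h2 h3 h4
      rw [h1, h4, Pi.add_apply, h2, h3, ← WithLp.toLp_add, ← hsplit]
      congr 2
      ext i
      cases i <;> rfl
    rw [hf']
    exact Submodule.add_mem_sup
      (Submodule.subset_span ⟨fun t i => φ t (Sum.inl i), fun i => hφ _, m₁.coeFn_toLp⟩)
      (Submodule.subset_span ⟨fun t i => φ t (Sum.inr i), fun i => hφ _, m₂.coeFn_toLp⟩)
  · refine Submodule.span_mono ?_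
    rintro f ⟨φ, hφ, hf⟩
    refine ⟨fun t => Sum.elim (φ t) 0, ?_, ?_⟩
    · rintro (i | i)
      · exact hφ i
      · exact IsHardy.zero
    · filter_upwards [hf] with t ht
      rw [ht, hsplit, Matrix.zero_vecMul, add_zero]
  · refine Submodule.span_mono ?_
    rintro f ⟨φ, hφ, hf⟩
    refine ⟨fun t => Sum.elim 0 (φ t), ?_, ?_⟩
    · rintro (i | i)
      · exact IsHardy.zero
      · exact hφ i
    · filter_upwards [hf] with t ht
      rw [ht, hsplit, Matrix.zero_vecMul, zero_add]

end rowSpan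

/-! ### Shift-invariant subspaces -/

section Beurling

variable [Fintype κ] [DecidableEq κ] {M : Submodule ℂ (L2 κ)}

/-- The wandering subspace `M ⊖ z⁻¹M` of a shift-invariant subspace `M`. -/
def wandering (M : Submodule ℂ (L2 κ)) : Submodule ℂ (L2 κ) :=
  M ⊓ (M.map (shift (-1)).toLinearMap)ᗮ

theorem inner_shift_wandering (hS : ∀ n : ℤ, n ≤ 0 → ∀ f ∈ M, shift n f ∈ M) {e e' : L2 κ}
    (he : e ∈ wandering M) (he' : e' ∈ wandering M) {n : ℤ} (hn : n < 0) :
    inner ℂ (shift n e) e' = 0 := by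
  refine (Submodule.mem_orthogonal _ _).1 he'.2 _ ⟨shift (n + 1) e, hS _ (by omega) e he.1, ?_⟩
  refine (shift_shift _ _ _).trans ?_
  congr 1
  ring_nf

/-- On the wandering subspace the inner product of `L²_κ` is attained pointwise: the scalar function
`t ↦ ⟨e(t), e'(t)⟩` has no nonzero Fourier frequencies. -/
theorem inner_apply_of_mem_wandering (hS : ∀ n : ℤ, n ≤ 0 → ∀ f ∈ M, shift n f ∈ M)
    {e e' : L2 κ} (he : e ∈ wandering M) (he' : e' ∈ wandering M) :
    ∀ᵐ t ∂circleMeasure, inner ℂ (e t) (e' t) = inner ℂ e e' := by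
  rw [L2.inner_def e e']
  refine ae_eq_const_of_fourierCoeff (L2.integrable_inner e e') fun n hn => ?_
  have key : fourierCoeff (fun t => inner ℂ (e t) (e' t)) n = inner ℂ (shift n e) e' := by
    rw [L2.inner_def, fourierCoeff]
    refine integral_congr_ae ?_
    filter_upwards [coeFn_shift n e] with t ht
    rw [ht, inner_smul_left, fourier_neg, smul_eq_mul]
  rw [key]
  rcases lt_or_gt_of_ne hn with h | h
  · exact inner_shift_wandering hS he he' h
  · rw [inner_shift, ← inner_conj_symm,
      inner_shift_wandering hS he' he (neg_lt_zero.2 h), map_zero]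

/-- The wandering subspace of a closed shift-invariant subspace has a finite basis that is
orthonormal pointwise almost everywhere, of length at most the number of coordinates. -/
theorem exists_pointwise_orthonormal_wandering (hM : IsClosed (M : Set (L2 κ)))
    (hS : ∀ n : ℤ, n ≤ 0 → ∀ f ∈ M, shift n f ∈ M) :
    ∃ r ≤ Fintype.card κ, ∃ e : Fin r → L2 κ, (∀ i, e i ∈ wandering M) ∧
      (∀ᵐ t ∂circleMeasure, ∀ i k, inner ℂ (e i t) (e k t) = if i = k then (1 : ℂ) else 0) ∧
      ∀ v ∈ wandering M, (∀ i, inner ℂ (e i) v = 0) → v = 0 := by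
  classical
  have hLc : IsClosed (wandering M : Set (L2 κ)) := hM.inter (Submodule.isClosed_orthogonal _)
  have : CompleteSpace (wandering M) := hLc.completeSpace_coe
  obtain ⟨w, b, -⟩ := exists_hilbertBasis ℂ (wandering M)
  have hpt : ∀ x y : w, ∀ᵐ t ∂circleMeasure,
      inner ℂ ((b x : L2 κ) t) ((b y : L2 κ) t) = if x = y then (1 : ℂ) else 0 := by
    intro x y
    filter_upwards [inner_apply_of_mem_wandering hS (b x).2 (b y).2] with t ht
    rw [ht, ← Submodule.coe_inner, orthonormal_iff_ite.1 b.orthonormal]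
  -- The values at almost every point form an orthonormal family in the finite-dimensional `ℂ^κ`.
  have hcard : ∀ s : Finset w, s.card ≤ Fintype.card κ := by
    intro s
    obtain ⟨t, ht⟩ := (eventually_countable_forall.2 fun x : s =>
      eventually_countable_forall.2 fun y : s => hpt x y).exists
    have hon : Orthonormal ℂ (fun x : s => ((b x : L2 κ) t)) := by
      rw [orthonormal_iff_ite]
      intro x y
      rw [ht x y]
      simp only [Subtype.coe_inj]
    simpa using hon.linearIndependent.fintype_card_le_finrank
  have hfin : Finite w := by
    by_contra hinf
    have : Infinite w := not_finite_iff_infinite.1 hinf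
    obtain ⟨s, hs⟩ := Infinite.exists_subset_card_eq w (Fintype.card κ + 1)
    have := hcard s
    omega
  have : Fintype w := Fintype.ofFinite w
  have eqv := Fintype.equivFin w
  refine ⟨Fintype.card w, hcard Finset.univ, fun i => b (eqv.symm i), fun i => (b _).2, ?_, ?_⟩
  · filter_upwards [eventually_countable_forall.2 fun x =>
      eventually_countable_forall.2 fun y => hpt x y] with t ht i k
    rw [ht]
    simp only [eqv.symm.injective.eq_iff]
  · intro v hv h
    have hv0 : (⟨v, hv⟩ : wandering M) = 0 := by
      refine b.repr.injective (lp.ext (funext fun x => ?_))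
      rw [map_zero, b.repr_apply_apply, Submodule.coe_inner]
      obtain ⟨i, rfl⟩ := eqv.symm.surjective x
      exact h i
    exact congrArg Subtype.val hv0

/-- **Beurling–Lax theorem** for the Hardy space of the exterior of the disc: a closed
shift-invariant subspace of `H²_κ` is `H² D` with `D` inner, having at most as many rows as columns.
The rows of `D` are an orthonormal basis of the wandering subspace. -/
theorem exists_isInner_H2Mul_eq (hM : IsClosed (M : Set (L2 κ))) (hMH : M ≤ H2 κ)
    (hS : ∀ n : ℤ, n ≤ 0 → ∀ f ∈ M, shift n f ∈ M) :
    ∃ r ≤ Fintype.card κ, ∃ D : Torus → Matrix (Fin r) κ ℂ, IsInner D ∧ H2Mul D = M := by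
  set SM := M.map (shift (-1)).toLinearMap
  have hSMc : IsClosed (SM : Set (L2 κ)) :=
    (shift (κ := κ) (-1)).isometry.isClosedEmbedding.isClosedMap _ hM
  have hSMM : SM ≤ M := by
    rintro _ ⟨g, hg, rfl⟩
    exact hS _ (by norm_num) g hg
  have : CompleteSpace SM := hSMc.completeSpace_coe
  obtain ⟨r, hr, e, heL, hpt, htotal⟩ := exists_pointwise_orthonormal_wandering hM hS
  refine ⟨r, hr, fun t => Matrix.of fun i j => e i t j, ?_⟩
  set D : Torus → Matrix (Fin r) κ ℂ := fun t => Matrix.of fun i j => e i t j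
  have hDD : ∀ᵐ t ∂circleMeasure, D t * (D t)ᴴ = 1 := by
    filter_upwards [hpt] with t ht
    ext i k
    have := ht k i
    rw [EuclideanSpace.inner_eq_star_dotProduct] at this
    rw [Matrix.one_apply]
    exact Eq.trans rfl (this.trans (if_congr eq_comm rfl rfl))
  have hinner : IsInner D := by
    refine ⟨fun i j => ⟨?_, (hMH (heL i).1 j).2⟩, hDD⟩
    refine memLp_top_of_bound (memLp_coord (e i) j).1 1 ?_
    filter_upwards [hDD] with t ht
    exact norm_entry_le_one ht i j
  have hrow : ∀ i, rightMul D hinner.aestronglyMeasurable hinner.2 (monomial 0 i) = e i := by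
    intro i
    refine Lp.ext ?_
    filter_upwards [rightMul_monomial_zero hinner.aestronglyMeasurable hinner.2 i] with t ht
    ext j
    exact ht j
  have hrowmem : ∀ i, e i ∈ H2Mul D := by
    intro i
    rw [← hrow, H2Mul_eq_map hinner.aestronglyMeasurable hinner.2]
    exact ⟨_, monomial_mem_H2 le_rfl i, rfl⟩
  have hle : H2Mul D ≤ M := H2Mul_le hinner hM hS fun i => by
    rw [hrow]
    exact (heL i).1
  refine ⟨hinner, le_antisymm hle fun f hf => ?_⟩
  have : CompleteSpace (H2Mul D) := hinner.isClosed_H2Mul.completeSpace_coe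
  obtain ⟨y, hy, z, hz, rfl⟩ := (H2Mul D).exists_add_mem_mem_orthogonal f
  have hzM : z ∈ M := by simpa using Submodule.sub_mem _ hf (hle hy)
  -- Being orthogonal to all shifts of the wandering subspace, `z` is divisible by every power.
  have hdiv : ∀ k : ℕ, ∃ g ∈ M, z = shift (-(k : ℤ)) g := by
    intro k
    induction k with
    | zero => exact ⟨z, hzM, by simp [shift_zero]⟩
    | succ k ih =>
      obtain ⟨g, hg, hzg⟩ := ih
      obtain ⟨u, hu, v, hv, rfl⟩ := SM.exists_add_mem_mem_orthogonal g
      have hvM : v ∈ M := by simpa using Submodule.sub_mem _ hg (hSMM hu)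
      have hv0 : v = 0 := by
        refine htotal v ⟨hvM, hv⟩ fun i => ?_
        have h1 : inner ℂ (e i) (u + v) = 0 := by
          rw [← (shift (-(k : ℤ))).inner_map_map, ← hzg]
          exact (Submodule.mem_orthogonal _ _).1 hz _
            (shift_mem_H2Mul hinner (by omega) (hrowmem i))
        have h2 : inner ℂ (e i) u = 0 :=
          Submodule.inner_left_of_mem_orthogonal hu (heL i).2
        rwa [inner_add_right, h2, zero_add] at h1
      obtain ⟨g', hg', rfl⟩ := hu
      refine ⟨g', hg', ?_⟩
      rw [hzg, hv0, add_zero]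
      refine (shift_shift _ _ _).trans ?_
      congr 1
      push_cast
      ring_nf
  have hz0 : z = 0 := by
    refine eq_zero_of_inner_monomial fun n j => ?_
    obtain ⟨g, hg, rfl⟩ := hdiv (1 - n).toNat
    rw [← inner_shift, shift_monomial]
    exact (mem_H2_iff g).1 (hMH hg) _ (by omega) j
  rw [hz0, add_zero]
  exact hy

end Beurling

/-! ### Common divisors -/

theorem H2Mul_eq_H2_iff [Fintype κ] [DecidableEq κ] {D : Torus → Matrix κ κ ℂ} (hD : IsInner D) :
    H2Mul D = H2 κ ↔ ∃ U ∈ Matrix.unitaryGroup κ ℂ, ∀ᵐ t ∂circleMeasure, D t = U := by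
  constructor
  · intro h
    obtain ⟨R, hR, hRD⟩ := exists_isInner_factor isInner_one hD (H2Mul_one.trans h.symm).le
    have hRstar : ∀ᵐ t ∂circleMeasure, R t = (D t)ᴴ := by
      filter_upwards [hRD, hD.2] with t h1 h2
      rw [← Matrix.mul_one (R t), ← h2, ← Matrix.mul_assoc, ← h1, Matrix.one_mul]
    -- Both `D` and `D^*` are analytic.
    have hconst : ∀ i j, ∀ᵐ t ∂circleMeasure, D t i j = ∫ s, D s i j ∂circleMeasure := by
      intro i j
      refine (hD.1 i j).ae_eq_const_of_conj le_top ((hR.1 j i).congr ?_)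
      filter_upwards [hRstar] with t ht
      rw [ht]
      rfl
    have hall : ∀ᵐ t ∂circleMeasure, D t = Matrix.of fun i j => ∫ s, D s i j ∂circleMeasure := by
      filter_upwards [eventually_countable_forall.2 fun i =>
        eventually_countable_forall.2 fun j => hconst i j] with t ht
      ext i j
      exact ht i j
    refine ⟨_, ?_, hall⟩
    obtain ⟨t, h1, h2⟩ := (hall.and hD.2).exists
    rw [← h1]
    exact Matrix.mem_unitaryGroup_iff.2 h2
  · rintro ⟨U, hU, hDU⟩
    refine le_antisymm (H2Mul_le_H2 hD) fun f hf => ?_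
    have hUU : Uᴴ * U = 1 := Matrix.mem_unitaryGroup_iff'.1 hU
    have hin : IsInner (fun _ : Torus => Uᴴ) :=
      isInner_const (by rw [Matrix.conjTranspose_conjTranspose, hUU])
    refine ⟨rightMul _ hin.aestronglyMeasurable hin.2 f, H2Mul_le_H2 hin ?_, ?_⟩
    · rw [H2Mul_eq_map hin.aestronglyMeasurable hin.2]
      exact ⟨f, hf, rfl⟩
    · filter_upwards [hDU, coeFn_rightMul hin.aestronglyMeasurable hin.2 f] with t h1 h2
      rw [h1, h2, Matrix.vecMul_vecMul, hUU, Matrix.vecMul_one]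

theorem H2Mul_le_of_eq_mul [Fintype ρ] [Fintype σ] [Fintype κ] [DecidableEq ρ] [DecidableEq σ]
    {Q : Torus → Matrix ρ κ ℂ} {R : Torus → Matrix ρ σ ℂ} {D : Torus → Matrix σ κ ℂ}
    (hR : IsInner R) (h : ∀ᵐ t ∂circleMeasure, Q t = R t * D t) : H2Mul Q ≤ H2Mul D := by
  rintro f ⟨g, hg, hf⟩
  refine ⟨rightMul R hR.aestronglyMeasurable hR.2 g, H2Mul_le_H2 hR ?_, ?_⟩
  · rw [H2Mul_eq_map hR.aestronglyMeasurable hR.2]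
    exact ⟨g, hg, rfl⟩
  · filter_upwards [h, hf, coeFn_rightMul hR.aestronglyMeasurable hR.2 g] with t h1 h2 h3
    rw [h2, h1, h3, Matrix.vecMul_vecMul]

/-- When the rows of `Q₁` and `Q₂` together span `ℂ^m` almost everywhere, right-coprimeness means
that `H² Q₁ + H² Q₂` is dense in `H²`. The rank condition makes the inner function representing the
closed sum square, so that it is itself a common right inner divisor. -/
theorem rightCoprime_iff_closure_eq {m : ℕ} [Fintype ρ] [Fintype σ] [DecidableEq ρ]
    [DecidableEq σ] {Q₁ : Torus → Matrix ρ (Fin m) ℂ} {Q₂ : Torus → Matrix σ (Fin m) ℂ}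
    (h₁ : IsInner Q₁) (h₂ : IsInner Q₂)
    (hrank : ∀ᵐ t ∂circleMeasure, m ≤ (Matrix.fromRows (Q₁ t) (Q₂ t)).rank) :
    RightCoprime Q₁ Q₂ ↔ (H2Mul Q₁ ⊔ H2Mul Q₂).topologicalClosure = H2 (Fin m) := by
  constructor
  · intro hcop
    set M := (H2Mul Q₁ ⊔ H2Mul Q₂).topologicalClosure with hM
    have hMH : M ≤ H2 (Fin m) := Submodule.topologicalClosure_minimal _
      (sup_le (H2Mul_le_H2 h₁) (H2Mul_le_H2 h₂)) isClosed_H2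
    have hS : ∀ n : ℤ, n ≤ 0 → ∀ f ∈ M, shift n f ∈ M := by
      intro n hn
      refine Submodule.topologicalClosure_minimal _ (t := M.comap (shift n).toLinearMap) ?_
        ((Submodule.isClosed_topologicalClosure _).preimage (shift n).continuous)
      refine sup_le (fun f hf => ?_) (fun f hf => ?_)
      · exact Submodule.le_topologicalClosure _
          (Submodule.mem_sup_left (shift_mem_H2Mul h₁ hn hf))
      · exact Submodule.le_topologicalClosure _
          (Submodule.mem_sup_right (shift_mem_H2Mul h₂ hn hf))
    obtain ⟨r, hr, D, hD, hDM⟩ :=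
      exists_isInner_H2Mul_eq (Submodule.isClosed_topologicalClosure _) hMH hS
    obtain ⟨R₁, hR₁, e₁⟩ := exists_isInner_factor h₁ hD
      (hDM.symm ▸ le_sup_left.trans (Submodule.le_topologicalClosure _))
    obtain ⟨R₂, hR₂, e₂⟩ := exists_isInner_factor h₂ hD
      (hDM.symm ▸ le_sup_right.trans (Submodule.le_topologicalClosure _))
    have hrm : r = m := by
      refine le_antisymm (by simpa using hr) ?_
      obtain ⟨t, ht, a₁, a₂⟩ := (hrank.and (e₁.and e₂)).exists
      rw [a₁, a₂, ← Matrix.fromRows_mul] at ht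
      exact ht.trans ((Matrix.rank_mul_le_right _ _).trans (D t).rank_le_height)
    subst hrm
    exact hDM.symm.trans <| (H2Mul_eq_H2_iff hD).2 (hcop D ⟨hD, R₁, hR₁, e₁⟩ ⟨hD, R₂, hR₂, e₂⟩)
  · rintro hM D ⟨hD, R₁, hR₁, e₁⟩ ⟨-, R₂, hR₂, e₂⟩
    refine (H2Mul_eq_H2_iff hD).1 (le_antisymm (H2Mul_le_H2 hD) ?_)
    rw [← hM]
    exact Submodule.topologicalClosure_minimal _
      (sup_le (H2Mul_le_of_eq_mul hR₁ e₁) (H2Mul_le_of_eq_mul hR₂ e₂)) hD.isClosed_H2Mul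

end HardyMatrix

end

theorem mainTheorem5 (m p r₁ r₂ : ℕ)
    (W : HardyMatrix.Torus → Matrix (Fin m ⊕ Fin p) (Fin m) ℂ)
    (hW : HardyMatrix.IsHardyMatrix 2 W)
    (hrank : ∀ᵐ t ∂HardyMatrix.circleMeasure, (W t).rank = m)
    (G₁ : HardyMatrix.Torus → Matrix (Fin m) (Fin r₁) ℂ)
    (Q₁ : HardyMatrix.Torus → Matrix (Fin r₁) (Fin m) ℂ)
    (G₂ : HardyMatrix.Torus → Matrix (Fin p) (Fin r₂) ℂ)
    (Q₂ : HardyMatrix.Torus → Matrix (Fin r₂) (Fin m) ℂ)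
    (h₁ : HardyMatrix.IsOuterInnerFactorization (fun t => (W t).toRows₁) G₁ Q₁)
    (h₂ : HardyMatrix.IsOuterInnerFactorization (fun t => (W t).toRows₂) G₂ Q₂) :
    (HardyMatrix.IsOuter W ↔ HardyMatrix.RightCoprime Q₁ Q₂) ∧
    (HardyMatrix.RightCoprime Q₁ Q₂ ↔
      HardyMatrix.IsGreatestCommonRightInnerDivisor (fun _ => 1) Q₁ Q₂) := by
  have hQ : ∀ᵐ t ∂HardyMatrix.circleMeasure, m ≤ (Matrix.fromRows (Q₁ t) (Q₂ t)).rank := by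
    filter_upwards [hrank, h₁.2.2, h₂.2.2] with t h e₁ e₂
    have hfac : W t = Matrix.fromBlocks (G₁ t) 0 0 (G₂ t) * Matrix.fromRows (Q₁ t) (Q₂ t) := by
      rw [← Matrix.fromRows_toRows (W t), e₁, e₂, Matrix.fromBlocks_mul_fromRows]
      simp
    rw [hfac] at h
    exact h.symm.le.trans (Matrix.rank_mul_le_right _ _)
  have hcop := HardyMatrix.rightCoprime_iff_closure_eq h₁.2.1 h₂.2.1 hQ
  have hspan : (HardyMatrix.rowSpan W).topologicalClosure =
      (HardyMatrix.H2Mul Q₁ ⊔ HardyMatrix.H2Mul Q₂).topologicalClosure := by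
    rw [HardyMatrix.rowSpan_eq_sup hW, ← HardyMatrix.closure_sup_closure, h₁.closure_rowSpan,
      h₂.closure_rowSpan]
  refine ⟨?_, ?_⟩
  · rw [hcop, ← hspan]
    exact ⟨fun h => h.2, fun h => ⟨hW, h⟩⟩
  · rw [hcop]
    refine ⟨fun h => ⟨HardyMatrix.isInner_one, ?_⟩, fun h => ?_⟩
    · rw [HardyMatrix.H2Mul_one, h]
    · rw [← h.2, HardyMatrix.H2Mul_one]
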